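/- Let $n$ be a natural number, let $q\neq 0$ be a complex number with $q^i\neq 1$ for $1\le i\le n$, and write $[N]=\frac{1-q^N}{1-q}$, $(a;q)_N=\prod_{i=1}^{N}(1-aq^{i-1})$ (so $(a;q)_0=1$) and $\genfrac{[}{]}{0pt}{}{n}{r}=\frac{[n][n-1]\cdots[n-r+1]}{[r][r-1]\cdots[1]}$ for $0\le r\le n$. For $x\in\mathbb{C}$ and positive integers $N,s_1,\dots,s_p$ ($p\ge 1$) put, with $i_0=N$, \[ H_N[s_1,\dots,s_p;x]=\frac{q^{N(s_1-1)}}{[N]^{s_1-1}}\sum_{N\ge i_1\ge\cdots\ge i_{p-1}\ge 1}\frac{q^{i_1(s_2-1)+\cdots+i_{p-1}(s_p-1)}}{[i_1]^{s_2}\cdots[i_{p-1}]^{s_p}}\,x^{i_{p-1}}, \] \[ U_N[s_1,\dots,s_p;x]=\frac{1}{[N]^{s_1-1}}\sum_{N\ge i_1\ge\cdots\ge i_{p-1}\ge 1}\frac{q^{i_1+\cdots+i_{p-1}}}{[i_1]^{s_2}\cdots[i_{p-1}]^{s_p}}\,\bigl(1-(x;q)_{i_{p-1}}\bigr), \] where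 for $p=1$ the sums are read as $x^N$ and $1-(x;q)_N$ respectively. Let $\{1\}^s$ denote $s$ copies of the argument $1$; where $\{1\}^{s-1}$ with $s=0$ occurs between two arguments $a+1$ and $b+1$, the segment $a+1,\{1\}^{s-1},b+1$ is understood as the single argument $a+b+1$. Then for every integer $k\ge 1$, all non-negative integers $m_1,\dots,m_k$ and $n_1,\dots,n_k$, and all complex $x,y,z$ such that $yz\neq q^{-r}$ for every integer $r\ge 0$, \[ \begin{aligned} &\sum_{r=1}^{n}\genfrac{[}{]}{0pt}{}{n}{r}(-1)^{r-1}q^{\binom r2}y^r\frac{(z;q)_r}{(yz;q)_r}\,H_r[m_1+1,\{1\}^{n_1-1},m_2+1,\{1\}^{n_2-1},m_3+1,\dots,\{1\}^{n_{k-1}-1},m_k+1,\{1\}^{n_k};x]\\ &\quad=\frac{1}{(yz;q)_n}\sum_{r=1}^{n}\genfrac{[}{]}{0pt}{}{n}{r}y^r(z;q)_r(y;q)_{n-r}\,U_r[\{1\}^{m_1},n_1+1,\{1\}^{m_2-1},n_2+1,\{1\}^{m_3-1},n_3+1,\dots,\{1\}^{m_k-1},n_k+1;x]. \end{aligned} \]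 -/

import Mathlib

open Finset

noncomputable section

namespace QDuality

/-- The `q`-shifted factorial `(x;q)_n = ∏_{i=1}^{n} (1 - x q^{i-1})`, with `(x;q)_0 = 1`. -/
def qPoch (q x : ℂ) (n : ℕ) : ℂ :=
  ∏ i ∈ range n, (1 - x * q ^ i)

/-- The `q`-number `[n] = (1 - q^n) / (1 - q)`. -/
def qNum (q : ℂ) (n : ℕ) : ℂ :=
  (1 - q ^ n) / (1 - q)

/-- The Gaussian binomial coefficient `([n][n-1]⋯[n-r+1]) / ([r][r-1]⋯[1])`. -/
def qBinom (q : ℂ) (n r : ℕ) : ℂ :=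
  (∏ i ∈ range r, qNum q (n - i)) / ∏ i ∈ range r, qNum q (i + 1)

/-- For `l = [s_2, …, s_k]`, the nested sum over `N ≥ i_1 ≥ ⋯ ≥ i_{k-1} ≥ 1` of
`q^{i_1 (s_2 - 1) + ⋯ + i_{k-1} (s_k - 1)} / ([i_1]^{s_2} ⋯ [i_{k-1}]^{s_k}) * x^{i_{k-1}}`,
where `i_0 = N`, so that the value for the empty list is `x^N`. -/
def hSum (q x : ℂ) : ℕ → List ℕ → ℂ
  | N, [] => x ^ N
  | N, s :: l => ∑ i ∈ Icc 1 N, q ^ (i * (s - 1)) / qNum q i ^ s * hSum q x i l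

/-- For `l = [s_2, …, s_k]`, the nested sum over `N ≥ i_1 ≥ ⋯ ≥ i_{k-1} ≥ 1` of
`q^{i_1 + ⋯ + i_{k-1}} / ([i_1]^{s_2} ⋯ [i_{k-1}]^{s_k}) * (1 - (x;q)_{i_{k-1}})`,
where `i_0 = N`, so that the value for the empty list is `1 - (x;q)_N`. -/
def uSum (q x : ℂ) : ℕ → List ℕ → ℂ
  | N, [] => 1 - qPoch q x N
  | N, s :: l => ∑ i ∈ Icc 1 N, q ^ i / qNum q i ^ s * uSum q x i l

/-- The generalized `q`-multiple harmonic sum `H_N[s_1, …, s_k; x]`, for a non-empty list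
of positive integers `s_1, …, s_k` (the value at the empty list is irrelevant). -/
def H (q x : ℂ) (N : ℕ) : List ℕ → ℂ
  | [] => 0
  | s :: l => q ^ (N * (s - 1)) / qNum q N ^ (s - 1) * hSum q x N l

/-- The generalized `q`-multiple harmonic sum `U_N[s_1, …, s_k; x]`, for a non-empty list
of positive integers `s_1, …, s_k` (the value at the empty list is irrelevant). -/
def U (q x : ℂ) (N : ℕ) : List ℕ → ℂ
  | [] => 0
  | s :: l => 1 / qNum q N ^ (s - 1) * uSum q x N l

/-- With `(m, n) = (m_1, n_1)` and the list `(m_2, n_2), …, (m_k, n_k)`, the argument list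
`m_1 + 1, {1}^{n_1 - 1}, m_2 + 1, {1}^{n_2 - 1}, …, {1}^{n_{k-1} - 1}, m_k + 1, {1}^{n_k}`,
where, by convention, `a + 1, {1}^{0 - 1}, b + 1` stands for the single entry `a + b + 1`. -/
def hIndexAux : ℕ → ℕ → List (ℕ × ℕ) → List ℕ
  | m, n, [] => (m + 1) :: List.replicate n 1
  | m, 0, (m', n') :: rest => hIndexAux (m + m') n' rest
  | m, n + 1, (m', n') :: rest => (m + 1) :: (List.replicate n 1 ++ hIndexAux m' n' rest)

/-- With `n = n_1` and the list `(m_2, n_2), …, (m_k, n_k)`, the argument list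
`n_1 + 1, {1}^{m_2 - 1}, n_2 + 1, {1}^{m_3 - 1}, …, {1}^{m_k - 1}, n_k + 1`,
where, by convention, `a + 1, {1}^{0 - 1}, b + 1` stands for the single entry `a + b + 1`. -/
def uIndexAux : ℕ → List (ℕ × ℕ) → List ℕ
  | n, [] => [n + 1]
  | n, (0, n') :: rest => uIndexAux (n + n') rest
  | n, (m' + 1, n') :: rest => (n + 1) :: (List.replicate m' 1 ++ uIndexAux n' rest)

/-- The argument list
`m_1 + 1, {1}^{n_1 - 1}, m_2 + 1, …, {1}^{n_{k-1} - 1}, m_k + 1, {1}^{n_k}`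
of `H`, formed from the pairs `(m_1, n_1), …, (m_k, n_k)`, `k ≥ 1`. -/
def hIndex : List (ℕ × ℕ) → List ℕ
  | [] => []
  | (m, n) :: rest => hIndexAux m n rest

/-- The argument list `{1}^{m_1}, n_1 + 1, {1}^{m_2 - 1}, n_2 + 1, …, {1}^{m_k - 1}, n_k + 1`
of `U`, formed from the pairs `(m_1, n_1), …, (m_k, n_k)`, `k ≥ 1`. -/
def uIndex : List (ℕ × ℕ) → List ℕ
  | [] => []
  | (m, n) :: rest => List.replicate m 1 ++ uIndexAux n rest

end QDuality

end

/-!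
The `q`-binomial transform `T F (N) = ∑_{r=1}^N (-1)^{r-1} q^{r(r-1)/2} [N choose r] F(r)` sends
`x^r` to `1 - (x;q)_N`, turns multiplication of `F` by `q^r / [r]` into the operator
`G ↦ ∑_{i ≤ N} q^i / [i] * G(i)`, and turns the operator `F ↦ ∑_{i ≤ r} F(i) / [i]` into division
by `[N]`. On the `F` side the two moves raise the first argument of `H` by one or put a new
argument `1` in front of it; on the `T F` side they do the opposite to the arguments of `U`.
Starting from `H[1]` and `U[1]`, the transform of `H[s]` is therefore `U[t]`, with `t` the Hoffman
dual of `s`, and the two argument lists of the theorem are Hoffman dual. The parameters `y, z` enter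
by weighting `T F` with the terms of a `q`-Vandermonde sum: the coefficient of each `F(s)` is then
again a `q`-Vandermonde sum.
-/

namespace QDuality

variable {q : ℂ} {N : ℕ}

/-- The condition `q, q ^ 2, …, q ^ N ≠ 1`, under which the `q`-numbers `[1], …, [N]` are nonzero
and division by them is meaningful. -/
def Regular (q : ℂ) (N : ℕ) : Prop :=
  ∀ i : ℕ, 1 ≤ i → i ≤ N → q ^ i ≠ 1

namespace Regular

lemma mono {M : ℕ} (h : Regular q N) (hMN : M ≤ N) : Regular q M :=
  fun i hi hiM => h i hi (hiM.trans hMN)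

lemma ne_one (h : Regular q N) (hN : 1 ≤ N) : q ≠ 1 := by
  simpa using h 1 le_rfl hN

lemma qNum_ne_zero (h : Regular q N) {i : ℕ} (hi : 1 ≤ i) (hiN : i ≤ N) : qNum q i ≠ 0 :=
  div_ne_zero (sub_ne_zero.2 (h i hi hiN).symm)
    (sub_ne_zero.2 (h.ne_one (hi.trans hiN)).symm)

end Regular

@[simp] lemma qNum_zero (q : ℂ) : qNum q 0 = 0 := by
  simp [qNum]

lemma qNum_add (hq : q ≠ 1) (a b : ℕ) : qNum q (a + b) = qNum q a + q ^ a * qNum q b := by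
  have : 1 - q ≠ 0 := sub_ne_zero.2 hq.symm
  simp only [qNum]
  field_simp
  ring

/-- The `q`-factorial `[N][N-1]⋯[1]`, used to rewrite Gaussian binomial coefficients in a form
symmetric in the two lower arguments. -/
noncomputable def qFact (q : ℂ) (N : ℕ) : ℂ :=
  ∏ i ∈ range N, qNum q (i + 1)

lemma qFact_succ (q : ℂ) (N : ℕ) : qFact q (N + 1) = qFact q N * qNum q (N + 1) :=
  prod_range_succ _ _

lemma Regular.qFact_ne_zero (h : Regular q N) : qFact q N ≠ 0 :=
  prod_ne_zero_iff.2 fun _ hi => h.qNum_ne_zero (Nat.succ_pos _) (mem_range.1 hi)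

lemma prod_qNum_sub_mul_qFact (q : ℂ) (r t : ℕ) :
    (∏ i ∈ range r, qNum q (r + t - i)) * qFact q t = qFact q (r + t) := by
  induction r generalizing t with
  | zero => simp
  | succ r ih =>
    rw [prod_range_succ, show r + 1 + t - r = t + 1 by omega, mul_assoc, mul_comm (qNum q _),
      ← qFact_succ, show r + 1 + t = r + (t + 1) by omega, ih]

@[simp] lemma qBinom_zero_right (q : ℂ) (N : ℕ) : qBinom q N 0 = 1 := by
  simp [qBinom]

lemma qBinom_eq_zero_of_lt (q : ℂ) {r : ℕ} (h : N < r) : qBinom q N r = 0 := by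
  rw [qBinom, prod_eq_zero (mem_range.2 h) (by simp), zero_div]

lemma qBinom_succ_right (q : ℂ) (N r : ℕ) :
    qBinom q N (r + 1) = qBinom q N r * (qNum q (N - r) / qNum q (r + 1)) := by
  rw [qBinom, prod_range_succ, prod_range_succ, mul_div_mul_comm, qBinom]

lemma qBinom_succ_right_eq (h : Regular q N) (r : ℕ) :
    qBinom q N (r + 1) * qNum q (r + 1) = qBinom q N r * qNum q (N - r) := by
  rcases lt_or_ge r N with hr | hr
  · have hr0 : qNum q (r + 1) ≠ 0 := h.qNum_ne_zero (by omega) hr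
    rw [qBinom_succ_right]
    field_simp
  · rw [qBinom_eq_zero_of_lt q (Nat.lt_succ_iff.2 hr), Nat.sub_eq_zero_of_le hr, qNum_zero,
      zero_mul, mul_zero]

lemma qBinom_succ_succ (q : ℂ) (N r : ℕ) :
    qBinom q (N + 1) (r + 1) = qBinom q N r * (qNum q (N + 1) / qNum q (r + 1)) := by
  rw [qBinom, prod_range_succ', prod_range_succ, mul_div_mul_comm]
  simp [qBinom]

lemma qBinom_add_eq_div {t : ℕ} (ht : Regular q t) (r : ℕ) :
    qBinom q (r + t) r = qFact q (r + t) / (qFact q r * qFact q t) := by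
  rw [← prod_qNum_sub_mul_qFact, mul_div_mul_right _ _ ht.qFact_ne_zero, qBinom, qFact]

lemma qBinom_mul_qBinom {s t u : ℕ} (h : Regular q (s + t + u)) :
    qBinom q (s + t + u) (s + t) * qBinom q (s + t) s =
      qBinom q (s + t + u) s * qBinom q (t + u) t := by
  have hst : qFact q (s + t) ≠ 0 := (h.mono (by omega)).qFact_ne_zero
  have htu : qFact q (t + u) ≠ 0 := (h.mono (by omega)).qFact_ne_zero
  have expand_left : qBinom q (s + t + u) s =
      qFact q (s + t + u) / (qFact q s * qFact q (t + u)) := by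
    rw [add_assoc, qBinom_add_eq_div (h.mono (by omega))]
  rw [expand_left, qBinom_add_eq_div (h.mono (by omega)), qBinom_add_eq_div (h.mono (by omega)),
    qBinom_add_eq_div (h.mono (by omega))]
  field_simp

lemma qBinom_pascal (h : Regular q (N + 1)) {r : ℕ} (hr : r ≤ N) :
    qBinom q (N + 1) (r + 1) = qBinom q N (r + 1) + q ^ (N - r) * qBinom q N r := by
  have hr0 : qNum q (r + 1) ≠ 0 := h.qNum_ne_zero (by omega) (by omega)
  have split : qNum q (N + 1) = qNum q (N - r) + q ^ (N - r) * qNum q (r + 1) := by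
    rw [← qNum_add (h.ne_one (by omega)), show N - r + (r + 1) = N + 1 by omega]
  rw [qBinom_succ_succ, qBinom_succ_right, split]
  field_simp

lemma sum_qBinom_succ_mul (h : Regular q (N + 1)) (f : ℕ → ℂ) :
    ∑ r ∈ range (N + 2), qBinom q (N + 1) r * f r =
      ∑ r ∈ range (N + 1), qBinom q N r * (f r + q ^ (N - r) * f (r + 1)) := by
  have shift : ∑ r ∈ range (N + 1), qBinom q N r * f r =
      ∑ r ∈ range (N + 1), qBinom q N (r + 1) * f (r + 1) + f 0 := by
    have := sum_range_succ' (fun r => qBinom q N r * f r) (N + 1)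
    rwa [sum_range_succ, qBinom_eq_zero_of_lt q (Nat.lt_succ_self N), zero_mul, add_zero,
      qBinom_zero_right, one_mul] at this
  simp only [mul_add, sum_add_distrib]
  rw [sum_range_succ', shift, add_right_comm, ← sum_add_distrib, qBinom_zero_right, one_mul]
  congr 1
  refine sum_congr rfl fun r hr => ?_
  rw [qBinom_pascal h (mem_range_succ_iff.1 hr)]
  ring

lemma qPoch_succ (q x : ℂ) (N : ℕ) : qPoch q x (N + 1) = qPoch q x N * (1 - x * q ^ N) :=
  prod_range_succ _ _

lemma qPoch_add (q x : ℂ) (a b : ℕ) :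
    qPoch q x (a + b) = qPoch q x a * qPoch q (x * q ^ a) b := by
  simp only [qPoch, prod_range_add, pow_add, mul_assoc]

lemma qPoch_ne_zero (hx : ∀ r : ℕ, x ≠ q ^ (-(r : ℤ))) (N : ℕ) : qPoch q x N ≠ 0 := by
  refine prod_ne_zero_iff.2 fun i _ h => hx i ?_
  rw [zpow_neg, zpow_natCast]
  exact eq_inv_of_mul_eq_one_left (sub_eq_zero.1 h).symm

lemma q_vandermonde (h : Regular q N) (y z : ℂ) :
    ∑ r ∈ range (N + 1), qBinom q N r * (y ^ r * qPoch q z r * qPoch q y (N - r)) =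
      qPoch q (y * z) N := by
  induction N with
  | zero => simp [qPoch]
  | succ N ih =>
    rw [sum_qBinom_succ_mul h, qPoch_succ, ← ih (h.mono N.le_succ), sum_mul]
    refine sum_congr rfl fun r hr => ?_
    obtain ⟨t, rfl⟩ := Nat.exists_eq_add_of_le (mem_range_succ_iff.1 hr)
    rw [show r + t + 1 - r = t + 1 by omega, show r + t + 1 - (r + 1) = t by omega,
      Nat.add_sub_cancel_left, qPoch_succ, qPoch_succ]
    ring

lemma q_binomial_theorem (h : Regular q N) (x : ℂ) :
    ∑ r ∈ range (N + 1), qBinom q N r * ((-1) ^ r * q ^ r.choose 2 * x ^ r) = qPoch q x N := by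
  induction N with
  | zero => simp [qPoch]
  | succ N ih =>
    rw [sum_qBinom_succ_mul h, qPoch_succ, ← ih (h.mono N.le_succ), sum_mul]
    refine sum_congr rfl fun r hr => ?_
    obtain ⟨t, rfl⟩ := Nat.exists_eq_add_of_le (mem_range_succ_iff.1 hr)
    rw [Nat.add_sub_cancel_left, Nat.choose_succ_succ' r 1, Nat.choose_one_right]
    ring

/-- The `q`-binomial transform of a sequence `F`, which carries `H` to `U`. It leaves out `F 0` and
takes the sign `(-1) ^ (r - 1)`, so that the term `r = 1` is positive. -/
noncomputable def qTransform (q : ℂ) (F : ℕ → ℂ) (N : ℕ) : ℂ :=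
  ∑ r ∈ Icc 1 N, (-1) ^ (r - 1) * q ^ r.choose 2 * qBinom q N r * F r

lemma qTransform_pow (h : Regular q N) (x : ℂ) :
    qTransform q (fun r => x ^ r) N = 1 - qPoch q x N := by
  rw [← q_binomial_theorem h, sum_range_eq_add_Ico _ (Nat.add_one_pos N), Ico_add_one_right_eq_Icc,
    qTransform]
  simp only [qBinom_zero_right, pow_zero, Nat.choose_zero_succ, mul_one, sub_add_cancel_left,
    ← sum_neg_distrib]
  refine sum_congr rfl fun r hr => ?_
  obtain ⟨r, rfl⟩ := Nat.exists_eq_add_of_le' (mem_Icc.1 hr).1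
  rw [Nat.add_sub_cancel]
  ring

lemma qBinom_succ_sub_qBinom_mul (h : Regular q (N + 1)) {r : ℕ} (hr : 1 ≤ r) (hrN : r ≤ N + 1) :
    (qBinom q (N + 1) r - qBinom q N r) * (q ^ r / qNum q r) =
      q ^ (N + 1) / qNum q (N + 1) * qBinom q (N + 1) r := by
  obtain ⟨r, rfl⟩ := Nat.exists_eq_add_of_le' hr
  have hr0 : qNum q (r + 1) ≠ 0 := h.qNum_ne_zero hr hrN
  have hN0 : qNum q (N + 1) ≠ 0 := h.qNum_ne_zero (by omega) le_rfl
  have hpow : q ^ (N + 1) = q ^ (N - r) * q ^ (r + 1) := by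
    rw [← pow_add, show N - r + (r + 1) = N + 1 by omega]
  rw [qBinom_pascal h (by omega), add_sub_cancel_left, ← qBinom_pascal h (by omega),
    qBinom_succ_succ, hpow]
  field_simp

lemma qTransform_succ_sub (h : Regular q (N + 1)) (F : ℕ → ℂ) :
    qTransform q (fun r => q ^ r / qNum q r * F r) (N + 1) -
        qTransform q (fun r => q ^ r / qNum q r * F r) N =
      q ^ (N + 1) / qNum q (N + 1) * qTransform q F (N + 1) := by
  have extend : qTransform q (fun r => q ^ r / qNum q r * F r) N =
      ∑ r ∈ Icc 1 (N + 1),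
        (-1) ^ (r - 1) * q ^ r.choose 2 * qBinom q N r * (q ^ r / qNum q r * F r) := by
    rw [sum_Icc_succ_top (by omega), qBinom_eq_zero_of_lt q N.lt_succ_self, mul_zero, zero_mul,
      add_zero, qTransform]
  rw [extend, qTransform, qTransform, ← sum_sub_distrib, mul_sum]
  refine sum_congr rfl fun r hr => ?_
  obtain ⟨hr1, hrN⟩ := mem_Icc.1 hr
  linear_combination (-1) ^ (r - 1) * q ^ r.choose 2 * F r * qBinom_succ_sub_qBinom_mul h hr1 hrN

lemma qTransform_pow_div_qNum_mul (h : Regular q N) (F : ℕ → ℂ) :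
    qTransform q (fun r => q ^ r / qNum q r * F r) N =
      ∑ i ∈ Icc 1 N, q ^ i / qNum q i * qTransform q F i := by
  induction N with
  | zero => simp [qTransform]
  | succ N ih =>
    rw [sum_Icc_succ_top (by omega), ← ih (h.mono N.le_succ), ← qTransform_succ_sub h,
      add_sub_cancel]

lemma sum_Icc_neg_one_pow_mul_qBinom (h : Regular q N) {i : ℕ} (hi : 1 ≤ i) (hiN : i ≤ N) :
    ∑ r ∈ Icc i N, (-1) ^ (r - 1) * q ^ r.choose 2 * qBinom q N r =
      (-1) ^ (i - 1) * q ^ i.choose 2 * qBinom q N i * (qNum q i / qNum q N) := by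
  let t (r : ℕ) : ℂ := (-1) ^ r * q ^ r.choose 2 * qBinom q N r * (qNum q r / qNum q N)
  have telescope (r : ℕ) (hr : r ∈ Icc i N) :
      (-1) ^ (r - 1) * q ^ r.choose 2 * qBinom q N r = t (r + 1) - t r := by
    obtain ⟨hir, hrN⟩ := mem_Icc.1 hr
    have hN0 : qNum q N ≠ 0 := h.qNum_ne_zero (hi.trans hiN) le_rfl
    have split : qNum q N = qNum q r + q ^ r * qNum q (N - r) := by
      rw [← qNum_add (h.ne_one (hi.trans hiN)), Nat.add_sub_cancel' hrN]
    obtain ⟨r, rfl⟩ := Nat.exists_eq_add_of_le' (hi.trans hir)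
    have hchoose : (r + 1 + 1).choose 2 = r + 1 + (r + 1).choose 2 := by
      rw [Nat.choose_succ_succ' (r + 1) 1, Nat.choose_one_right]
    simp only [t, hchoose, Nat.add_sub_cancel]
    field_simp
    linear_combination (-1) ^ r * q ^ (r + 1).choose 2 *
      (qBinom q N (r + 1) * split - q ^ (r + 1) * qBinom_succ_right_eq h (r + 1))
  have t_top : t (N + 1) = 0 := by
    simp only [t, qBinom_eq_zero_of_lt q N.lt_succ_self, mul_zero, zero_mul]
  rw [sum_congr rfl telescope, sum_Icc_sub hiN, t_top]
  obtain ⟨i, rfl⟩ := Nat.exists_eq_add_of_le' hi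
  simp only [t, Nat.add_sub_cancel]
  ring

lemma qTransform_sum_div_qNum (h : Regular q N) (F : ℕ → ℂ) :
    qTransform q (fun r => ∑ i ∈ Icc 1 r, F i / qNum q i) N = qTransform q F N / qNum q N := by
  simp only [qTransform, mul_sum, sum_div]
  rw [sum_comm' (t' := Icc 1 N) (s' := fun i => Icc i N)
    (by intro a b; simp only [mem_Icc]; omega)]
  refine sum_congr rfl fun i hi => ?_
  obtain ⟨hi1, hiN⟩ := mem_Icc.1 hi
  have hi0 : qNum q i ≠ 0 := h.qNum_ne_zero hi1 hiN
  rw [← sum_mul, sum_Icc_neg_one_pow_mul_qBinom h hi1 hiN]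
  field_simp

/-- Hoffman duality between the argument lists of `H` and of `U`, generated from the front: raising
the first entry on one side puts a new entry `1` in front on the other. -/
inductive HoffmanDual : List ℕ → List ℕ → Prop
  | one : HoffmanDual [1] [1]
  | raise_left {s t : List ℕ} (h : HoffmanDual s t) :
      HoffmanDual (s.modifyHead (· + 1)) (1 :: t)
  | raise_right {s t : List ℕ} (h : HoffmanDual s t) :
      HoffmanDual (1 :: s) (t.modifyHead (· + 1))

lemma HoffmanDual.exists_eq_cons {s t : List ℕ} (h : HoffmanDual s t) :
    (∃ a l, s = (a + 1) :: l) ∧ ∃ b l, t = (b + 1) :: l := by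
  induction h with
  | one => exact ⟨⟨0, _, rfl⟩, ⟨0, _, rfl⟩⟩
  | raise_left _ ih =>
    obtain ⟨⟨a, l, rfl⟩, -⟩ := ih
    exact ⟨⟨a + 1, l, rfl⟩, ⟨0, _, rfl⟩⟩
  | raise_right _ ih =>
    obtain ⟨-, ⟨b, l, rfl⟩⟩ := ih
    exact ⟨⟨0, _, rfl⟩, ⟨b + 1, l, rfl⟩⟩

lemma H_one_cons (q x : ℂ) (N s : ℕ) (l : List ℕ) :
    H q x N (1 :: (s + 1) :: l) = ∑ i ∈ Icc 1 N, H q x i ((s + 1) :: l) / qNum q i := by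
  simp only [H, hSum, Nat.sub_self, mul_zero, pow_zero, div_one, one_mul, Nat.add_sub_cancel]
  exact sum_congr rfl fun i _ => by rw [pow_succ, ← div_div, div_mul_eq_mul_div]

lemma H_succ_succ_cons (q x : ℂ) (N s : ℕ) (l : List ℕ) :
    H q x N ((s + 1 + 1) :: l) = q ^ N / qNum q N * H q x N ((s + 1) :: l) := by
  simp only [H, Nat.add_sub_cancel]
  rw [Nat.mul_succ, pow_add, pow_succ, mul_div_mul_comm]
  ring

lemma U_one_cons (q x : ℂ) (N s : ℕ) (l : List ℕ) :
    U q x N (1 :: (s + 1) :: l) = ∑ i ∈ Icc 1 N, q ^ i / qNum q i * U q x i ((s + 1) :: l) := by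
  simp only [U, uSum, Nat.sub_self, pow_zero, div_one, one_mul, Nat.add_sub_cancel]
  exact sum_congr rfl fun i _ => by
    rw [← mul_assoc, div_mul_div_comm, mul_one, ← pow_succ']

lemma U_succ_succ_cons (q x : ℂ) (N s : ℕ) (l : List ℕ) :
    U q x N ((s + 1 + 1) :: l) = U q x N ((s + 1) :: l) / qNum q N := by
  simp only [U, Nat.add_sub_cancel]
  rw [pow_succ, ← div_div, div_mul_eq_mul_div]

lemma HoffmanDual.qTransform_H {s t : List ℕ} (hst : HoffmanDual s t) (x : ℂ) (hq : Regular q N) :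
    qTransform q (fun r => H q x r s) N = U q x N t := by
  induction hst generalizing N with
  | one => simpa [H, U, hSum, uSum] using qTransform_pow hq x
  | raise_left hst ih =>
    obtain ⟨⟨a, l, rfl⟩, ⟨b, l', rfl⟩⟩ := hst.exists_eq_cons
    simp only [List.modifyHead_cons, H_succ_succ_cons]
    rw [qTransform_pow_div_qNum_mul hq, U_one_cons]
    exact sum_congr rfl fun i hi => by rw [ih (hq.mono (mem_Icc.1 hi).2)]
  | raise_right hst ih =>
    obtain ⟨⟨a, l, rfl⟩, ⟨b, l', rfl⟩⟩ := hst.exists_eq_cons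
    simp only [List.modifyHead_cons, H_one_cons]
    rw [qTransform_sum_div_qNum hq, ih hq, U_succ_succ_cons]

lemma hIndexAux_succ_left (m n : ℕ) (rest : List (ℕ × ℕ)) :
    hIndexAux (m + 1) n rest = (hIndexAux m n rest).modifyHead (· + 1) := by
  induction rest generalizing m n with
  | nil => rfl
  | cons p rest ih =>
    cases n with
    | zero => simp only [hIndexAux, ← ih, add_right_comm]
    | succ n => rfl

lemma hIndexAux_zero_succ (n : ℕ) (rest : List (ℕ × ℕ)) :
    hIndexAux 0 (n + 1) rest = 1 :: hIndexAux 0 n rest := by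
  cases rest with
  | nil => rfl
  | cons p rest =>
    cases n with
    | zero => simp [hIndexAux]
    | succ n => rfl

lemma uIndexAux_succ (n : ℕ) (rest : List (ℕ × ℕ)) :
    uIndexAux (n + 1) rest = (uIndexAux n rest).modifyHead (· + 1) := by
  induction rest generalizing n with
  | nil => rfl
  | cons p rest ih =>
    obtain ⟨m, n'⟩ := p
    cases m with
    | zero => simp only [uIndexAux, ← ih, add_right_comm]
    | succ m => rfl

lemma uIndexAux_zero_cons (p : ℕ × ℕ) (rest : List (ℕ × ℕ)) :
    uIndexAux 0 (p :: rest) = uIndex (p :: rest) := by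
  obtain ⟨_ | m, n⟩ := p
  · simp [uIndexAux, uIndex]
  · rfl

lemma hIndexAux_zero_zero_cons (p : ℕ × ℕ) (rest : List (ℕ × ℕ)) :
    hIndexAux 0 0 (p :: rest) = hIndex (p :: rest) := by
  rw [hIndexAux, zero_add, hIndex]

lemma hoffmanDual_hIndex_uIndex_cons (m n : ℕ) {rest : List (ℕ × ℕ)}
    (h : HoffmanDual (hIndexAux 0 0 rest) (uIndexAux 0 rest)) :
    HoffmanDual (hIndex ((m, n) :: rest)) (uIndex ((m, n) :: rest)) := by
  simp only [hIndex, uIndex]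
  induction m with
  | succ m ih => exact hIndexAux_succ_left m n rest ▸ ih.raise_left
  | zero =>
    induction n with
    | zero => exact h
    | succ n ih => exact hIndexAux_zero_succ n rest ▸ uIndexAux_succ n rest ▸ ih.raise_right

lemma hoffmanDual_hIndex_uIndex {l : List (ℕ × ℕ)} (hl : l ≠ []) :
    HoffmanDual (hIndex l) (uIndex l) := by
  induction l with
  | nil => contradiction
  | cons p rest ih =>
    refine hoffmanDual_hIndex_uIndex_cons p.1 p.2 ?_
    cases rest with
    | nil => exact .one
    | cons p' rest =>
      rw [hIndexAux_zero_zero_cons, uIndexAux_zero_cons]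
      exact ih (List.cons_ne_nil _ _)

lemma sum_Icc_q_vandermonde_mul_qBinom (h : Regular q N) {s : ℕ} (hs : s ≤ N) (y z : ℂ) :
    ∑ r ∈ Icc s N, qBinom q N r * y ^ r * qPoch q z r * qPoch q y (N - r) * qBinom q r s =
      qBinom q N s * y ^ s * qPoch q z s * qPoch q (y * z * q ^ s) (N - s) := by
  obtain ⟨M, rfl⟩ := Nat.exists_eq_add_of_le hs
  rw [Nat.add_sub_cancel_left, mul_assoc y z, ← q_vandermonde (h.mono (by omega)), mul_sum,
    ← Ico_add_one_right_eq_Icc, sum_Ico_eq_sum_range, show s + M + 1 - s = M + 1 by omega]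
  refine sum_congr rfl fun t ht => ?_
  obtain ⟨u, rfl⟩ := Nat.exists_eq_add_of_le (mem_range_succ_iff.1 ht)
  rw [← add_assoc] at h ⊢
  rw [qPoch_add, Nat.add_sub_cancel_left, Nat.add_sub_cancel_left, pow_add]
  linear_combination
    y ^ s * y ^ t * (qPoch q z s * qPoch q (z * q ^ s) t) * qPoch q y u * qBinom_mul_qBinom h

lemma sum_q_vandermonde_mul_qTransform (h : Regular q N) {y z : ℂ} (hyz : qPoch q (y * z) N ≠ 0)
    (F : ℕ → ℂ) :
    1 / qPoch q (y * z) N * ∑ r ∈ Icc 1 N,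
        qBinom q N r * y ^ r * qPoch q z r * qPoch q y (N - r) * qTransform q F r =
      ∑ r ∈ Icc 1 N, qBinom q N r * (-1) ^ (r - 1) * q ^ r.choose 2 * y ^ r *
        (qPoch q z r / qPoch q (y * z) r) * F r := by
  simp only [qTransform, mul_sum]
  rw [sum_comm' (t' := Icc 1 N) (s' := fun s => Icc s N)
    (by intro a b; simp only [mem_Icc]; omega)]
  refine sum_congr rfl fun s hs => ?_
  have hsN : s ≤ N := (mem_Icc.1 hs).2
  have split : qPoch q (y * z) N = qPoch q (y * z) s * qPoch q (y * z * q ^ s) (N - s) := by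
    rw [← qPoch_add, Nat.add_sub_cancel' hsN]
  have hs0 : qPoch q (y * z) s ≠ 0 := left_ne_zero_of_mul (split ▸ hyz)
  have hNs0 : qPoch q (y * z * q ^ s) (N - s) ≠ 0 := right_ne_zero_of_mul (split ▸ hyz)
  calc
    _ = 1 / qPoch q (y * z) N * ((-1) ^ (s - 1) * q ^ s.choose 2 * F s) *
        ∑ r ∈ Icc s N, qBinom q N r * y ^ r * qPoch q z r * qPoch q y (N - r) * qBinom q r s := by
      rw [mul_sum]
      exact sum_congr rfl fun r _ => by ring
    _ = _ := by
      rw [sum_Icc_q_vandermonde_mul_qBinom h hsN, split]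
      field_simp

end QDuality

open QDuality in
theorem proposition20_general {q : ℂ} {n : ℕ} (hq : Regular q n) (x : ℂ) {y z : ℂ}
    (hyz : qPoch q (y * z) n ≠ 0) {s t : List ℕ} (hst : HoffmanDual s t) :
    ∑ r ∈ Icc 1 n,
        qBinom q n r * (-1) ^ (r - 1) * q ^ r.choose 2 * y ^ r *
          (qPoch q z r / qPoch q (y * z) r) * H q x r s =
      1 / qPoch q (y * z) n *
        ∑ r ∈ Icc 1 n,
          qBinom q n r * y ^ r * qPoch q z r * qPoch q y (n - r) * U q x r t := by
  rw [← sum_q_vandermonde_mul_qTransform hq hyz]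
  congr 1
  refine sum_congr rfl fun r hr => ?_
  rw [hst.qTransform_H x (hq.mono (mem_Icc.1 hr).2)]

theorem proposition20 (q : ℂ) (hq0 : q ≠ 0) (n : ℕ)
    (hq : ∀ i : ℕ, 1 ≤ i → i ≤ n → q ^ i ≠ 1)
    (x y z : ℂ) (hyz : ∀ r : ℕ, y * z ≠ q ^ (-(r : ℤ)))
    (k : ℕ) (hk : 1 ≤ k) (ms ns : Fin k → ℕ) :
    ∑ r ∈ Finset.Icc 1 n,
        QDuality.qBinom q n r * (-1) ^ (r - 1) * q ^ (r.choose 2) * y ^ r *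
          (QDuality.qPoch q z r / QDuality.qPoch q (y * z) r) *
          QDuality.H q x r (QDuality.hIndex (List.ofFn fun j => (ms j, ns j))) =
      1 / QDuality.qPoch q (y * z) n *
        ∑ r ∈ Finset.Icc 1 n,
          QDuality.qBinom q n r * y ^ r * QDuality.qPoch q z r * QDuality.qPoch q y (n - r) *
            QDuality.U q x r (QDuality.uIndex (List.ofFn fun j => (ms j, ns j))) := by
  have hl : (List.ofFn fun j => (ms j, ns j)) ≠ [] := List.ofFn_eq_nil_iff.not.2 (by omega)
  exact proposition20_general hq x (QDuality.qPoch_ne_zero hyz n)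
    (QDuality.hoffmanDual_hIndex_uIndex hl)
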